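/- Let $(X,P)$ be a random walk (a Markov chain with transition matrix $P$) on the vertex set of a connected, locally finite graph $X$. Let $f^{(n)}(x,y)$ be the probability that the walk started at $x$ hits $y$ for the first time (at a time $\ge 1$) after $n$ steps, and put $F(x,y|z)=\sum_{n\ge1}f^{(n)}(x,y)z^n$. For a sequence $\lambda=(\lambda_n)_n$ of probability measures on $X$, a function $f$ on $X$ is in the domain $\mathcal D(L_\lambda)$ if $\sum_x|f(x)|\lambda_n(x)<\infty$ for all $n$ and $L_\lambda(f):=\lim_n\sum_x f(x)\lambda_n(x)$ exists and is finite. The walk is $\lambda$-TOA (transient on the average) if $\liminf_n\sum_x F(x,x|1)\lambda_n(x)<1$. For a vertex $o$, $L_o$ and TOA (with respect to $o$) refer to the uniform distributions $\lambda_n$ on the closed balls $B(o,n)$. The walk is TOA$_t$ (respectively ROA$_t$) with respect to $o$ if for some $\varepsilon\in(0,1)$ the function $x\mapsto F(x,x|z)$ is in $\mathcal D(L_o)$ for all $z\in(\varepsilon,1)$, and $\lim_{z\to1^-}L_o(F(\cdot,\cdot|z))$ exists and is $<1$ (respectively $=1$). (1) Let $m,n\ge2$, $m\ne n$, and let $\mathbb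 T_{m,n}$ be the bihomogeneous tree: every vertex has degree $m$ or $n$, all neighbours of a vertex of degree $m$ have degree $n$, and vice versa. The simple random walk on $\mathbb T_{m,n}$ is $\lambda$-TOA for every sequence $\lambda$ of probability measures; in particular it is TOA with respect to every vertex $o$. For every vertex $o$, the function $x\mapsto F(x,x|1)$ is not in $\mathcal D(L_o)$ (that is, $L_o(F)$ does not exist), and the walk is neither ROA$_t$ nor TOA$_t$ with respect to $o$. (2) Consequently the thermodynamical classification is not complete: there are an infinite, connected, locally finite graph, a vertex $o$ of it and a random walk on it which is neither ROA$_t$ nor TOA$_t$ with respect to $o$. (3) Let $k\ge3$, $n\ge2$, and let $T'_{k,n}$ be the tree whose vertices have degree $2$ or $k$, in which at least one vertex has degree $k$, and in which from every vertex of degree $k$, in each of its $k$ directions, one reaches another vertex of degree $k$ after exactly $n$ steps through vertices of degree $2$. The simple random walk on $T'_{k,n}$ is TOA with respect to every vertex $o$. (4) Let $k\ge3$, $n\ge2$, and let $T''_{k,n}$ be any tree whose vertices have degree $2$ or $k$, in which at least one vertex has degree $k$, and in which from every vertex of degree $k$, in each of its $k$ directions, one reaches another vertex of degree $k$ after at most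 $n$ steps (all vertices in between having degree $2$). The simple random walk on $T''_{k,n}$ is TOA with respect to every vertex $o$. -/

import Mathlib

open Filter Topology

universe u

namespace AvgRW

noncomputable section

/-- `P` is the transition matrix of a random walk (time-homogeneous Markov chain) on `X`. -/
structure IsRandomWalk {X : Type u} (P : X → X → ℝ) : Prop where
  nonneg : ∀ x y, 0 ≤ P x y
  hasSum_one : ∀ x, HasSum (P x) 1

open Classical in
/-- `firstHit P n x y` is `f^{(n)}(x,y)`, the probability that the walk started at `x` hits `y`
for the first time (at a time `≥ 1`) after exactly `n` steps, i.e. the sum over all paths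
`x = x₀, x₁, …, xₙ = y` with `x₁, …, xₙ₋₁ ≠ y` of `∏ P xᵢ xᵢ₊₁`. -/
def firstHit {X : Type u} (P : X → X → ℝ) : ℕ → X → X → ℝ
  | 0, _, _ => 0
  | 1, x, y => P x y
  | n + 2, x, y => ∑' w, if w = y then 0 else P x w * firstHit P (n + 1) w y

/-- `F(x,y|z) = ∑_{n ≥ 1} f^{(n)}(x,y) zⁿ` (the term `n = 0` vanishes). -/
def genF {X : Type u} (P : X → X → ℝ) (x y : X) (z : ℝ) : ℝ :=
  ∑' n : ℕ, firstHit P n x y * z ^ n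

open Classical in
/-- The simple random walk on a locally finite graph. -/
def simpleRW {X : Type u} (G : SimpleGraph X) [G.LocallyFinite] (x y : X) : ℝ :=
  if G.Adj x y then 1 / (G.degree x : ℝ) else 0

/-- On a graph without isolated vertices, `simpleRW` is a random walk. -/
theorem simpleRW_isRandomWalk {X : Type u} (G : SimpleGraph X) [G.LocallyFinite]
    (h : ∀ x, 0 < G.degree x) : IsRandomWalk (simpleRW G) where
  nonneg x y := by
    unfold simpleRW
    split_ifs <;> positivity
  hasSum_one x := by
    have hx : (G.degree x : ℝ) ≠ 0 := by exact_mod_cast (h x).ne'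
    have h1 : HasSum (simpleRW G x) (∑ y ∈ G.neighborFinset x, simpleRW G x y) := by
      apply hasSum_sum_of_ne_finset_zero
      intro y hy
      have : ¬ G.Adj x y := by simpa using hy
      simp [simpleRW, this]
    have h2 : ∑ y ∈ G.neighborFinset x, simpleRW G x y = 1 := by
      have : ∀ y ∈ G.neighborFinset x, simpleRW G x y = 1 / (G.degree x : ℝ) := by
        intro y hy
        have : G.Adj x y := by simpa using hy
        simp [simpleRW, this]
      rw [Finset.sum_congr rfl this, Finset.sum_const, G.card_neighborFinset_eq_degree,
        nsmul_eq_mul, mul_one_div_cancel hx]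
    rwa [h2] at h1

/-- `lam` is a sequence of probability measures on the (discrete) set `X`. -/
def IsProbSeq {X : Type u} (lam : ℕ → X → ℝ) : Prop :=
  ∀ n, (∀ x, 0 ≤ lam n x) ∧ HasSum (lam n) 1

/-- The average `∑_x f(x) λ_n(x)`. -/
def average {X : Type u} (lam : ℕ → X → ℝ) (f : X → ℝ) (n : ℕ) : ℝ :=
  ∑' x, f x * lam n x

/-- The real-valued functions in the domain `𝒟(L_λ)` of the limit on the `λ`-average. -/
def InDomain {X : Type u} (lam : ℕ → X → ℝ) (f : X → ℝ) : Prop :=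
  (∀ n, Summable fun x => |f x| * lam n x) ∧ ∃ l : ℝ, Tendsto (average lam f) atTop (𝓝 l)

/-- The limit on the average `L_λ(f)`, meaningful for `f` in the domain `𝒟(L_λ)`. -/
def limitAverage {X : Type u} (lam : ℕ → X → ℝ) (f : X → ℝ) : ℝ :=
  limUnder atTop (average lam f)

/-- The closed ball `B(o,n)` for the graph distance of a connected graph. -/
def graphBall {X : Type u} (G : SimpleGraph X) (o : X) (n : ℕ) : Set X :=
  {x | G.dist o x ≤ n}

/-- The uniform distributions `χ_{B(o,n)} / |B(o,n)|` on the balls centred at `o`. -/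
def ballLam {X : Type u} (G : SimpleGraph X) (o : X) (n : ℕ) (x : X) : ℝ :=
  (graphBall G o n).indicator 1 x / ((graphBall G o n).ncard : ℝ)

/-- `λ`-TOA: transience on the average, `liminf_n ∑_x F(x,x) λ_n(x) < 1`.
For a random walk and probability measures `λ_n` these averages lie in `[0,1]`. -/
def TOA {X : Type u} (P : X → X → ℝ) (lam : ℕ → X → ℝ) : Prop :=
  liminf (average lam fun x => genF P x x 1) atTop < 1

/-- Standing assumption of the thermodynamical classification:
`F(·,·|z) ∈ 𝒟(L_λ)` for all `z ∈ (ε,1)`, for some `ε ∈ (0,1)`. -/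
def ThermoAdmissible {X : Type u} (P : X → X → ℝ) (lam : ℕ → X → ℝ) : Prop :=
  ∃ ε ∈ Set.Ioo (0 : ℝ) 1, ∀ z ∈ Set.Ioo ε 1, InDomain lam fun x => genF P x x z

/-- `TOA_t`: thermodynamical transience on the average. -/
def TOAt {X : Type u} (P : X → X → ℝ) (lam : ℕ → X → ℝ) : Prop :=
  ThermoAdmissible P lam ∧ ∃ l < 1,
    Tendsto (fun z : ℝ => limitAverage lam fun x => genF P x x z) (𝓝[<] 1) (𝓝 l)

/-- `ROA_t`: thermodynamical recurrence on the average. -/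
def ROAt {X : Type u} (P : X → X → ℝ) (lam : ℕ → X → ℝ) : Prop :=
  ThermoAdmissible P lam ∧
    Tendsto (fun z : ℝ => limitAverage lam fun x => genF P x x z) (𝓝[<] 1) (𝓝 1)

/-- `G` is (a copy of) the bihomogeneous tree `𝕋_{m,n}`: a tree all of whose vertices have degree
`m` or `n`, the neighbours of a vertex of degree `m` having degree `n` and vice versa. -/
structure IsBihomogeneousTree {X : Type u} (G : SimpleGraph X) [G.LocallyFinite]
    (m n : ℕ) : Prop where
  isTree : G.IsTree
  degree : ∀ x, G.degree x = m ∨ G.degree x = n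
  adj_left : ∀ x y, G.Adj x y → G.degree x = m → G.degree y = n
  adj_right : ∀ x y, G.Adj x y → G.degree x = n → G.degree y = m

/-- `p` joins two consecutive ramifications (vertices of degree `k`): it is a non-trivial path
whose endpoints have degree `k` and whose inner vertices have degree `2`. -/
def IsBranch {X : Type u} (G : SimpleGraph X) [G.LocallyFinite] (k : ℕ) {x w : X}
    (p : G.Walk x w) : Prop :=
  p.IsPath ∧ 0 < p.length ∧ G.degree x = k ∧ G.degree w = k ∧
    ∀ i, 0 < i → i < p.length → G.degree (p.getVert i) = 2

/-- `G` is a tree with vertices of degree `2` or `k`, at least one of them of degree `k`, such that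
from each ramification, in each of the `k` directions, one meets a next ramification, and
its distance belongs to `L`. -/
structure IsRamifiedTree {X : Type u} (G : SimpleGraph X) [G.LocallyFinite]
    (k : ℕ) (L : Set ℕ) : Prop where
  isTree : G.IsTree
  degree : ∀ x, G.degree x = 2 ∨ G.degree x = k
  exists_ramification : ∃ x, G.degree x = k
  next_ramification : ∀ x y, G.degree x = k → G.Adj x y →
    ∃ (w : X) (p : G.Walk x w), IsBranch G k p ∧ p.getVert 1 = y ∧ p.length ∈ L

/-- The trees `T'_{k,n}`: consecutive ramifications are at distance exactly `n`. -/
def IsTreePrime {X : Type u} (G : SimpleGraph X) [G.LocallyFinite] (k n : ℕ) : Prop :=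
  IsRamifiedTree G k {n}

/-- The trees `T''_{k,n}`: consecutive ramifications are at distance at most `n`. -/
def IsTreeSecond {X : Type u} (G : SimpleGraph X) [G.LocallyFinite] (k n : ℕ) : Prop :=
  IsRamifiedTree G k {d | d ≤ n}

end

end AvgRW

/-! Transience. A nonnegative function that is `1` at `x` and superharmonic elsewhere dominates the
probability of hitting `x`, so its mean over the neighbours of `x` bounds F(x,x|1) (`genF_one_le`).
In a tree without leaves such a function comes from edge weights that are halved behind every vertex
of degree at least 3: it decreases linearly in the total weight of the path to `x`. If every long
path meets such a vertex within `N` steps, the total weight is at most N + N/2 + N/4 + ... = 2N,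
which gives F(x,x|1) ≤ 1 - 1/(4N) at every vertex (`genF_one_le_of_boundedThreads`). A uniform bound
below 1 survives averaging against any probability measures. It applies with N = 2 to bihomogeneous
trees and with N = n to the ramified ones.

Failure of averages. In a bihomogeneous tree with m ≠ n, F(x,x|z) depends only on the degree of `x`,
that is, on the parity of the distance to `o`. The first-passage equations are solved explicitly for
z < 1, and Abel's theorem carries the conclusions to z = 1; the two values differ for every 0 < z ≤
1 (`IsBihomogeneousTree.genF_ne`). Each sphere holds at least a quarter of its ball, so the newest
sphere keeps moving the average and no limit exists (`not_inDomain_of_parity`). Hence no range of z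
is admissible and both thermodynamical alternatives fail; a copy of the tree with degrees 2 and 3 on
ℕ is a concrete counterexample to completeness. -/

namespace AvgRW

/-! ### First-passage equations, comparison and uniqueness of solutions. -/

section FirstPassage

variable {X : Type u} (G : SimpleGraph X) [G.LocallyFinite]

theorem tsum_simpleRW_mul (x : X) (φ : X → ℝ) :
    ∑' w, simpleRW G x w * φ w = (∑ w ∈ G.neighborFinset x, φ w) / G.degree x := by
  rw [tsum_eq_sum (s := G.neighborFinset x), Finset.sum_div]
  · refine Finset.sum_congr rfl fun w hw => ?_
    have hw' : G.Adj x w := by simpa using hw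
    simp [simpleRW, hw', div_eq_inv_mul]
  · intro w hw
    have hw' : ¬ G.Adj x w := by simpa using hw
    simp [simpleRW, hw']

theorem simpleRW_nonneg (x y : X) : 0 ≤ simpleRW G x y := by
  unfold simpleRW
  split_ifs <;> positivity

theorem firstHit_nonneg (n : ℕ) (x y : X) : 0 ≤ firstHit (simpleRW G) n x y := by
  induction n generalizing x with
  | zero => simp [firstHit]
  | succ n ih =>
    cases n with
    | zero => exact simpleRW_nonneg G x y
    | succ n =>
      refine tsum_nonneg fun w => ?_
      split_ifs
      · exact le_rfl
      · exact mul_nonneg (simpleRW_nonneg G x w) (ih w)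

open Classical in
theorem firstHit_add_two (n : ℕ) (x y : X) :
    firstHit (simpleRW G) (n + 2) x y =
      (∑ w ∈ G.neighborFinset x, if w = y then 0 else firstHit (simpleRW G) (n + 1) w y) /
        G.degree x := by
  rw [← tsum_simpleRW_mul]
  change (∑' w, if w = y then 0 else _) = _
  refine tsum_congr fun w => ?_
  split_ifs <;> simp

/-- The partial sums of `F(x,y|z)` up to time `N`. -/
noncomputable def partialF (N : ℕ) (x y : X) (z : ℝ) : ℝ :=
  ∑ i ∈ Finset.range (N + 1), firstHit (simpleRW G) i x y * z ^ i

theorem partialF_zero (x y : X) (z : ℝ) : partialF G 0 x y z = 0 := by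
  simp [partialF, firstHit]

-- Conditioning on the first step. This recursion is all that the later arguments use about the
-- partial sums.
open Classical in
theorem partialF_succ (N : ℕ) (x y : X) (z : ℝ) :
    partialF G (N + 1) x y z =
      z * (∑ w ∈ G.neighborFinset x, if w = y then 1 else partialF G N w y z) / G.degree x := by
  have hone : simpleRW G x y =
      (∑ w ∈ G.neighborFinset x, if w = y then (1 : ℝ) else 0) / G.degree x := by
    rw [← tsum_simpleRW_mul, tsum_eq_single y]
    · simp
    · intro w hw
      simp [hw]
  have hsplit : ∀ w, (if w = y then (1 : ℝ) else partialF G N w y z) =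
      (if w = y then (1 : ℝ) else 0) + ∑ i ∈ Finset.range N,
        (if w = y then 0 else firstHit (simpleRW G) (i + 1) w y) * z ^ (i + 1) := by
    intro w
    split_ifs with h
    · simp
    · simp [partialF, Finset.sum_range_succ' _ N, firstHit]
  rw [partialF, Finset.sum_range_succ', Finset.sum_range_succ']
  simp only [hsplit, Finset.sum_add_distrib, firstHit_add_two]
  rw [Finset.sum_comm]
  have h0 : firstHit (simpleRW G) 0 x y = 0 := rfl
  have h1 : firstHit (simpleRW G) (0 + 1) x y = simpleRW G x y := rfl
  rw [h0, h1, hone, mul_add, add_div]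
  simp only [Finset.mul_sum, Finset.sum_div, Finset.sum_mul]
  simp only [zero_mul, add_zero]
  rw [add_comm]
  congr 1
  · refine Finset.sum_congr rfl fun w _ => ?_
    ring
  · refine Finset.sum_congr rfl fun i _ => ?_
    refine Finset.sum_congr rfl fun w _ => ?_
    ring

/-- A nonnegative function, equal to `1` at `x` and superharmonic elsewhere,
bounds the hitting probabilities of `x`. -/
theorem partialF_one_le {x : X} {h : X → ℝ} (h0 : ∀ y, 0 ≤ h y) (hx : h x = 1)
    (hdeg : ∀ y, 0 < G.degree y)
    (hsup : ∀ y, y ≠ x → ∑ w ∈ G.neighborFinset y, h w ≤ G.degree y * h y) (N : ℕ) :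
    partialF G N x x 1 ≤ (∑ w ∈ G.neighborFinset x, h w) / G.degree x := by
  classical
  have key : ∀ N y, partialF G N y x 1 ≤ (∑ w ∈ G.neighborFinset y, h w) / G.degree y := by
    intro N
    induction N with
    | zero =>
      intro y
      rw [partialF_zero]
      exact div_nonneg (Finset.sum_nonneg fun w _ => h0 w) (by positivity)
    | succ N ih =>
      intro y
      rw [partialF_succ, one_mul]
      gcongr with w hw
      split_ifs with hwx
      · rw [hwx, hx]
      · refine (ih w).trans ?_
        have := hdeg w
        rw [div_le_iff₀ (by exact_mod_cast this), mul_comm]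
        exact hsup w hwx
  exact key N x

/-- The bound on the partial sums does not depend on the time, and their terms are nonnegative.
Summability is recorded because Abel's theorem needs it. -/
theorem genF_one_le {x : X} {h : X → ℝ} (h0 : ∀ y, 0 ≤ h y) (hx : h x = 1)
    (hdeg : ∀ y, 0 < G.degree y)
    (hsup : ∀ y, y ≠ x → ∑ w ∈ G.neighborFinset y, h w ≤ G.degree y * h y) :
    Summable (fun n => firstHit (simpleRW G) n x x) ∧
      genF (simpleRW G) x x 1 ≤ (∑ w ∈ G.neighborFinset x, h w) / G.degree x := by
  have hb : ∀ n, ∑ i ∈ Finset.range n, firstHit (simpleRW G) i x x ≤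
      (∑ w ∈ G.neighborFinset x, h w) / G.degree x := by
    intro n
    refine le_trans ?_ (partialF_one_le G h0 hx hdeg hsup n)
    simp only [partialF, one_pow, mul_one]
    exact Finset.sum_le_sum_of_subset_of_nonneg
      (Finset.range_subset_range.2 (Nat.le_succ n)) fun i _ _ => firstHit_nonneg G i x x
  refine ⟨summable_of_sum_range_le (fun n => firstHit_nonneg G n x x) hb, ?_⟩
  simp only [genF, one_pow, mul_one]
  exact Real.tsum_le_of_sum_range_le (fun n => firstHit_nonneg G n x x) hb

theorem genF_one_nonneg (x : X) : 0 ≤ genF (simpleRW G) x x 1 :=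
  tsum_nonneg fun n => by simpa using firstHit_nonneg G n x x

/-- For `0 < z < 1` a bounded solution of the first-passage equations is the generating function. -/
theorem genF_eq_of_solution {x : X} {z : ℝ} (hz0 : 0 ≤ z) (hz1 : z < 1) {h : X → ℝ}
    (h0 : ∀ y, 0 ≤ h y) (h1 : ∀ y, h y ≤ 1) (hx : h x = 1) (hdeg : ∀ y, 0 < G.degree y)
    (hsol : ∀ y, y ≠ x → z * ∑ w ∈ G.neighborFinset y, h w = G.degree y * h y) :
    genF (simpleRW G) x x z = z * (∑ w ∈ G.neighborFinset x, h w) / G.degree x := by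
  classical
  -- One step of the recursion averages the errors and multiplies them by `z`; since 0 ≤ h ≤ 1 the
  -- initial error is at most 1, so it decays like z ^ N.
  have havg : ∀ (N : ℕ) (y : X), (∀ w, w ≠ x → |h w - partialF G N w x z| ≤ z ^ N) →
      |z * (∑ w ∈ G.neighborFinset y, h w) / G.degree y - partialF G (N + 1) y x z| ≤
        z ^ (N + 1) := by
    intro N y hN
    have hd : (0 : ℝ) < G.degree y := by exact_mod_cast hdeg y
    rw [partialF_succ, ← sub_div, ← mul_sub, ← Finset.sum_sub_distrib, abs_div, abs_mul,
      abs_of_nonneg hz0, abs_of_pos hd, div_le_iff₀ hd, pow_succ', mul_assoc]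
    gcongr
    refine (Finset.abs_sum_le_sum_abs _ _).trans ?_
    have : ∀ w ∈ G.neighborFinset y, |h w - if w = x then 1 else partialF G N w x z| ≤ z ^ N := by
      intro w _
      split_ifs with hw
      · rw [hw, hx]; simpa using pow_nonneg hz0 N
      · exact hN w hw
    refine (Finset.sum_le_card_nsmul _ _ _ this).trans ?_
    rw [G.card_neighborFinset_eq_degree, nsmul_eq_mul, mul_comm]
  have key : ∀ N w, w ≠ x → |h w - partialF G N w x z| ≤ z ^ N := by
    intro N
    induction N with
    | zero =>
      intro w _
      rw [partialF_zero, sub_zero, pow_zero, abs_of_nonneg (h0 w)]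
      exact h1 w
    | succ N ih =>
      intro w hw
      have hd : (G.degree w : ℝ) ≠ 0 := by exact_mod_cast (hdeg w).ne'
      have := havg N w ih
      rwa [hsol w hw, mul_div_cancel_left₀ _ hd] at this
  have hlim : Tendsto (fun n => ∑ i ∈ Finset.range n, firstHit (simpleRW G) i x x * z ^ i) atTop
      (𝓝 (z * (∑ w ∈ G.neighborFinset x, h w) / G.degree x)) := by
    rw [← tendsto_add_atTop_iff_nat 2]
    refine tendsto_iff_norm_sub_tendsto_zero.2 (squeeze_zero (fun _ => norm_nonneg _)
      (fun N => ?_) ((tendsto_pow_atTop_nhds_zero_of_lt_one hz0 hz1).comp (tendsto_add_atTop_nat 1)))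
    rw [norm_sub_rev]
    exact havg N x (key N)
  refine HasSum.tsum_eq ((hasSum_iff_tendsto_nat_of_nonneg (fun n => ?_) _).2 hlim)
  exact mul_nonneg (firstHit_nonneg G n x x) (pow_nonneg hz0 n)

/-- Abel's limit theorem, used to pass from z < 1, where bounded solutions are unique, to z = 1. -/
theorem tendsto_genF_nhdsLT_one {x : X} (hs : Summable fun n => firstHit (simpleRW G) n x x) :
    Tendsto (fun z => genF (simpleRW G) x x z) (𝓝[<] 1) (𝓝 (genF (simpleRW G) x x 1)) := by
  have := Real.tendsto_tsum_powerSeries_nhdsWithin_lt hs.hasSum.tendsto_sum_nat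
  simpa [genF] using this

end FirstPassage

/-! ### Averages against probability measures and uniform measures on balls. -/

section Averages

variable {X : Type u}

theorem average_mem_Icc {lam : ℕ → X → ℝ} (hlam : IsProbSeq lam) {f : X → ℝ} {c : ℝ}
    (h0 : ∀ x, 0 ≤ f x) (hc : ∀ x, f x ≤ c) (n : ℕ) : average lam f n ∈ Set.Icc 0 c := by
  obtain ⟨hn0, hn1⟩ := hlam n
  refine ⟨tsum_nonneg fun x => mul_nonneg (h0 x) (hn0 x), ?_⟩
  have hs : Summable fun x => c * lam n x := hn1.summable.mul_left c
  have hle : ∀ x, f x * lam n x ≤ c * lam n x := fun x => mul_le_mul_of_nonneg_right (hc x) (hn0 x)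
  refine (Summable.tsum_le_tsum hle
    (hs.of_nonneg_of_le (fun x => mul_nonneg (h0 x) (hn0 x)) hle) hs).trans ?_
  rw [tsum_mul_left, hn1.tsum_eq, mul_one]

/-- A walk with uniformly bounded return probabilities is transient on the average. -/
theorem TOA_of_genF_le {P : X → X → ℝ} {lam : ℕ → X → ℝ} (hlam : IsProbSeq lam) {c : ℝ}
    (hc1 : c < 1) (h0 : ∀ x, 0 ≤ genF P x x 1) (hc : ∀ x, genF P x x 1 ≤ c) : TOA P lam := by
  refine lt_of_le_of_lt (liminf_le_of_le ?_ fun b hb => ?_) hc1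
  -- The real `liminf` is meaningful only for a sequence bounded below.
  · exact ⟨0, eventually_map.2 (Eventually.of_forall fun n => (average_mem_Icc hlam h0 hc n).1)⟩
  · obtain ⟨n, hn⟩ := hb.exists
    exact hn.trans (average_mem_Icc hlam h0 hc n).2

variable (G : SimpleGraph X) [G.LocallyFinite]

theorem finite_graphBall (hG : G.Connected) (o : X) (n : ℕ) : (graphBall G o n).Finite := by
  induction n with
  | zero =>
    refine (Set.finite_singleton o).subset fun x hx => ?_
    have : G.dist o x = 0 := by simpa [graphBall] using hx
    exact (hG.dist_eq_zero_iff.1 this).symm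
  | succ n ih =>
    refine (ih.union (ih.biUnion fun y _ => (G.neighborSet y).toFinite)).subset fun x hx => ?_
    have hx' : G.dist o x ≤ n + 1 := hx
    rcases Nat.lt_or_ge (G.dist o x) (n + 1) with h | h
    · exact Or.inl (Nat.lt_succ_iff.1 h)
    · right
      obtain ⟨p, hp⟩ := hG.exists_walk_length_eq_dist x o
      cases p with
      | nil => simp at h
      | @cons _ y _ hadj q =>
        simp only [SimpleGraph.Walk.length_cons] at hp
        rw [SimpleGraph.dist_comm] at hp
        refine Set.mem_biUnion (x := y) ?_ hadj.symm
        have := SimpleGraph.dist_le q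
        rw [SimpleGraph.dist_comm] at this
        change G.dist o y ≤ n
        omega

theorem ballLam_isProbSeq (hG : G.Connected) (o : X) : IsProbSeq (ballLam G o) := by
  intro n
  refine ⟨fun x => div_nonneg (Set.indicator_nonneg (fun _ _ => zero_le_one) _) (by positivity), ?_⟩
  have hfin := finite_graphBall G hG o n
  have hne : (graphBall G o n).Nonempty := ⟨o, by simp [graphBall]⟩
  have hpos : ((graphBall G o n).ncard : ℝ) ≠ 0 := by
    exact_mod_cast (hne.ncard_pos hfin).ne'
  have h1 : HasSum ((graphBall G o n).indicator (1 : X → ℝ)) ((graphBall G o n).ncard : ℝ) := by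
    have : HasSum ((graphBall G o n).indicator (1 : X → ℝ))
        (∑ x ∈ hfin.toFinset, (graphBall G o n).indicator (1 : X → ℝ) x) :=
      hasSum_sum_of_ne_finset_zero fun x hx => by simp at hx; simp [hx]
    convert this using 1
    rw [Set.ncard_eq_toFinset_card _ hfin, Finset.card_eq_sum_ones, Nat.cast_sum]
    refine Finset.sum_congr rfl fun x hx => ?_
    have : x ∈ graphBall G o n := by simpa using hx
    simp [this]
  have := h1.div_const ((graphBall G o n).ncard : ℝ)
  rwa [div_self hpos] at this

theorem average_ballLam_mul_ncard (hG : G.Connected) (o : X) (f : X → ℝ) (n : ℕ) :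
    average (ballLam G o) f n * (graphBall G o n).ncard =
      ∑ x ∈ (finite_graphBall G hG o n).toFinset, f x := by
  have hfin := finite_graphBall G hG o n
  have hne : (graphBall G o n).Nonempty := ⟨o, by simp [graphBall]⟩
  have hpos : ((graphBall G o n).ncard : ℝ) ≠ 0 := by
    exact_mod_cast (hne.ncard_pos hfin).ne'
  have hsum : average (ballLam G o) f n = ∑ x ∈ hfin.toFinset, f x * ballLam G o n x := by
    refine tsum_eq_sum fun x hx => ?_
    have : x ∉ graphBall G o n := by simpa using hx
    simp [ballLam, this]
  rw [hsum, Finset.sum_mul]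
  refine Finset.sum_congr rfl fun x hx => ?_
  have : x ∈ graphBall G o n := by simpa using hx
  simp [ballLam, this, hpos]

end Averages
-- Paths in trees and uniform transience from bounded threads.
section Trees

open SimpleGraph

variable {X : Type u} {G : SimpleGraph X}

/-- The path from `y` to `x` in a tree. -/
noncomputable def treePath (hG : G.IsTree) (y x : X) : G.Walk y x :=
  (hG.existsUnique_path y x).choose

theorem treePath_isPath (hG : G.IsTree) (y x : X) : (treePath hG y x).IsPath :=
  (hG.existsUnique_path y x).choose_spec.1

theorem treePath_eq (hG : G.IsTree) {y x : X} {p : G.Walk y x} (hp : p.IsPath) :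
    treePath hG y x = p :=
  ((hG.existsUnique_path y x).choose_spec.2 p hp).symm

theorem treePath_self (hG : G.IsTree) (x : X) : treePath hG x x = Walk.nil :=
  treePath_eq hG Walk.IsPath.nil

theorem length_treePath (hG : G.IsTree) (y x : X) : (treePath hG y x).length = G.dist y x := by
  obtain ⟨p, hp, hl⟩ := hG.connected.exists_path_of_dist y x
  rw [treePath_eq hG hp, hl]

/-- Away from `x`, exactly one neighbour of `y` lies on the path from `y` to `x`, and the paths
from all other neighbours pass through `y`. -/
theorem exists_parent (hG : G.IsTree) {x y : X} (hyx : y ≠ x) :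
    ∃ (y' : X) (h : G.Adj y y'), treePath hG y x = Walk.cons h (treePath hG y' x) ∧
      ∀ w, w ≠ y' → ∀ hw : G.Adj w y, treePath hG w x = Walk.cons hw (treePath hG y x) := by
  have hp := treePath_isPath hG y x
  generalize treePath hG y x = p at hp
  cases p with
  | nil => exact absurd rfl hyx
  | @cons _ y' _ h q =>
    refine ⟨y', h, ?_, fun w hw hadj => ?_⟩
    · rw [treePath_eq hG hp.of_cons]
    · refine treePath_eq hG (hp.cons fun hmem => hw ?_)
      simpa using hG.isAcyclic.eq_snd_of_adj_start hp hadj.symm hmem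

theorem treePath_of_adj (hG : G.IsTree) {x w : X} (h : G.Adj w x) :
    treePath hG w x = Walk.cons h (treePath hG x x) := by
  rw [treePath_self]
  exact treePath_eq hG h.isPath_toWalk

/-- For functions of the path to a root: `y'` is the parent of `y`, and all children share the value
`c`. -/
theorem sum_neighborFinset_eq [G.LocallyFinite] {φ : X → ℝ} {y y' : X} {c : ℝ} (h : G.Adj y y')
    (hφ : ∀ w, w ≠ y' → G.Adj w y → φ w = c) :
    ∑ w ∈ G.neighborFinset y, φ w = φ y' + (G.degree y - 1) * c := by
  classical
  have hy' : y' ∈ G.neighborFinset y := by simpa using h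
  rw [← Finset.add_sum_erase _ _ hy', Finset.sum_congr rfl
    (g := fun _ => c) (fun w hw => ?_), Finset.sum_const, Finset.card_erase_of_mem hy',
    G.card_neighborFinset_eq_degree, nsmul_eq_mul,
    Nat.cast_sub (show 1 ≤ G.degree y from (G.degree_pos_iff_exists_adj y).2 ⟨y', h⟩), Nat.cast_one]
  obtain ⟨hne, hw⟩ := Finset.mem_erase.1 hw
  exact hφ w hne (by simpa [adj_comm] using hw)

variable [G.LocallyFinite]

/-- The weight of the first edge of a walk: it is halved at every later vertex of degree `≥ 3`. -/
noncomputable def edgeWeight : {y x : X} → G.Walk y x → ℝ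
  | _, _, .nil => 1
  | _, _, .cons (v := v) _ p => edgeWeight p * if 3 ≤ G.degree v then 1 / 2 else 1

/-- The sum of the weights of the edges of a walk. -/
noncomputable def pathWeight : {y x : X} → G.Walk y x → ℝ
  | _, _, .nil => 0
  | _, _, .cons h p => pathWeight p + edgeWeight (.cons h p)

/-- The number of initial edges of a walk with the same weight as the first. -/
def threadLength : {y x : X} → G.Walk y x → ℕ
  | _, _, .nil => 0
  | _, _, .cons (v := v) _ p => if 3 ≤ G.degree v then 1 else threadLength p + 1

theorem edgeWeight_pos {y x : X} (p : G.Walk y x) : 0 < edgeWeight p := by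
  induction p with
  | nil => simp [edgeWeight]
  | cons h p ih =>
    rw [edgeWeight]
    split_ifs <;> positivity

theorem threadLength_le_length {y x : X} (p : G.Walk y x) : threadLength p ≤ p.length := by
  induction p with
  | nil => simp [threadLength]
  | cons h p ih =>
    rw [threadLength, Walk.length_cons]
    split_ifs <;> omega

theorem degree_getVert_of_lt_threadLength {y x : X} (p : G.Walk y x) {i : ℕ} (hi : 0 < i)
    (hip : i < threadLength p) : G.degree (p.getVert i) < 3 := by
  induction p generalizing i with
  | nil => simp [threadLength] at hip
  | @cons u v w h p ih =>
    rw [threadLength] at hip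
    split_ifs at hip with hd
    · omega
    · obtain ⟨j, rfl⟩ : ∃ j, i = j + 1 := ⟨i - 1, by omega⟩
      rw [Walk.getVert_cons_succ]
      rcases Nat.eq_zero_or_pos j with rfl | hj
      · rw [Walk.getVert_zero]; exact not_le.1 hd
      · exact ih hj (by omega)

/-- Every path of `G` with more than `N` edges meets a vertex of degree at least `3`
after at least one and at most `N` steps. -/
def BoundedThreads (G : SimpleGraph X) [G.LocallyFinite] (N : ℕ) : Prop :=
  ∀ ⦃y x : X⦄ (p : G.Walk y x), p.IsPath → N < p.length →
    ∃ i, 0 < i ∧ i ≤ N ∧ 3 ≤ G.degree (p.getVert i)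

theorem BoundedThreads.threadLength_le {N : ℕ} (hN : BoundedThreads G N) {y x : X}
    {p : G.Walk y x} (hp : p.IsPath) : threadLength p ≤ N := by
  by_contra! hlt
  obtain ⟨i, hi0, hiN, hi⟩ := hN p hp (hlt.trans_le (threadLength_le_length p))
  exact absurd (degree_getVert_of_lt_threadLength p hi0 (hiN.trans_lt hlt)) (by omega)

/-- The second summand reserves room for any prolongation: N - t further edges of the current weight
W, then threads of total weight at most W(N/2 + N/4 + ...) = WN. Inside a thread the sum is
unchanged; at a halving it becomes the old path weight plus WN, which is no larger because t ≤ N. -/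
theorem BoundedThreads.pathWeight_add_le {N : ℕ} (hN : BoundedThreads G N) {y x : X}
    {p : G.Walk y x} (hp : p.IsPath) :
    pathWeight p + edgeWeight p * (2 * N - threadLength p) ≤ 2 * N := by
  induction p with
  | nil => simp [pathWeight, edgeWeight, threadLength]
  | @cons u v w h p ih =>
    have ih := ih hp.of_cons
    have ht : (threadLength p : ℝ) ≤ N := by exact_mod_cast hN.threadLength_le hp.of_cons
    have hw := edgeWeight_pos p
    rw [pathWeight, threadLength, edgeWeight]
    split_ifs
    · push_cast
      nlinarith [mul_nonneg hw.le (sub_nonneg.2 ht)]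
    · push_cast
      linarith

theorem BoundedThreads.pathWeight_le {N : ℕ} (hN : BoundedThreads G N) {y x : X}
    {p : G.Walk y x} (hp : p.IsPath) : pathWeight p ≤ 2 * N := by
  have ht : (threadLength p : ℝ) ≤ N := by exact_mod_cast hN.threadLength_le hp
  have h := hN.pathWeight_add_le hp
  nlinarith [mul_nonneg (edgeWeight_pos p).le (sub_nonneg.2 ht),
    mul_nonneg (edgeWeight_pos p).le (Nat.cast_nonneg (α := ℝ) N)]

/-- A tree without leaves and with bounded threads is uniformly transient. -/
theorem genF_one_le_of_boundedThreads (hG : G.IsTree) (hdeg : ∀ x, 2 ≤ G.degree x) {N : ℕ}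
    (hN0 : 0 < N) (hN : BoundedThreads G N) (x : X) :
    Summable (fun n => firstHit (simpleRW G) n x x) ∧
      genF (simpleRW G) x x 1 ≤ 1 - 1 / (4 * N) := by
  have hNr : (0 : ℝ) < N := by exact_mod_cast hN0
  set h : X → ℝ := fun y => 1 - pathWeight (treePath hG y x) / (2 * N) with hh
  have hx : h x = 1 := by simp [hh, treePath_self, pathWeight]
  have hpos : ∀ y, 0 < G.degree y := fun y => lt_of_lt_of_le two_pos (hdeg y)
  have h0 : ∀ y, 0 ≤ h y := by
    intro y
    have := hN.pathWeight_le (treePath_isPath hG y x)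
    rw [hh]
    exact sub_nonneg.2 ((div_le_one (by positivity)).2 this)
  have hsup : ∀ y, y ≠ x → ∑ w ∈ G.neighborFinset y, h w ≤ G.degree y * h y := by
    intro y hy
    obtain ⟨y', hadj, hpath, hother⟩ := exists_parent hG hy
    set W := edgeWeight (treePath hG y x) with hW
    have hWpos : 0 < W := edgeWeight_pos _
    have hy' : h y' = h y + W / (2 * N) := by
      have : pathWeight (treePath hG y x) = pathWeight (treePath hG y' x) + W := by
        rw [hW, hpath, pathWeight]
      simp only [hh, this]
      ring
    have hc : ∀ w, w ≠ y' → G.Adj w y →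
        h w = h y - W * (if 3 ≤ G.degree y then 1 / 2 else 1) / (2 * N) := by
      intro w hw hwy
      simp only [hh, hother w hw hwy, pathWeight, edgeWeight]
      rw [← hW]
      ring
    rw [sum_neighborFinset_eq hadj hc, hy']
    have hd2 : (2 : ℝ) ≤ G.degree y := by exact_mod_cast hdeg y
    have hV : 0 < W / (2 * N) := by positivity
    -- The total drop towards the children outweighs the rise towards the parent: at degree at least
    -- 3 there are at least two children with half the weight, at degree 2 one with the full weight.
    have hkey : 1 ≤ ((G.degree y : ℝ) - 1) * (if 3 ≤ G.degree y then 1 / 2 else 1) := by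
      split_ifs with h3
      · have : (3 : ℝ) ≤ G.degree y := by exact_mod_cast h3
        linarith
      · linarith
    have : ∀ q : ℝ, W * q / (2 * N) = q * (W / (2 * N)) := fun q => by ring
    rw [this]
    nlinarith [mul_le_mul_of_nonneg_right hkey hV.le]
  obtain ⟨hs, hle⟩ := genF_one_le G h0 hx hpos hsup
  refine ⟨hs, hle.trans ?_⟩
  have hd : (0 : ℝ) < G.degree x := by exact_mod_cast hpos x
  rw [div_le_iff₀ hd, mul_comm, ← G.card_neighborFinset_eq_degree, ← nsmul_eq_mul]
  refine Finset.sum_le_card_nsmul _ _ _ fun w hw => ?_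
  have hw' : G.Adj w x := by simpa [adj_comm] using hw
  simp only [hh, treePath_of_adj hG hw', treePath_self, pathWeight, edgeWeight]
  -- An edge at `x` has weight 1 or 1/2, the latter if `x` itself has degree at least 3; hence 4N
  -- rather than 2N in the bound.
  have : (1 / 2 : ℝ) ≤ 0 + 1 * (if 3 ≤ G.degree x then 1 / 2 else 1) := by
    split_ifs <;> norm_num
  have h4 : 1 / (4 * (N : ℝ)) = (1 / 2) / (2 * N) := by field_simp; norm_num
  rw [h4]
  gcongr

theorem TOA_of_boundedThreads (hG : G.IsTree) (hdeg : ∀ x, 2 ≤ G.degree x) {N : ℕ}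
    (hN0 : 0 < N) (hN : BoundedThreads G N) {lam : ℕ → X → ℝ} (hlam : IsProbSeq lam) :
    TOA (simpleRW G) lam := by
  have hNr : (0 : ℝ) < N := by exact_mod_cast hN0
  have hpos : 0 < 1 / (4 * (N : ℝ)) := by positivity
  exact TOA_of_genF_le hlam (sub_lt_self 1 hpos) (genF_one_nonneg G)
    fun x => (genF_one_le_of_boundedThreads hG hdeg hN0 hN x).2

end Trees
-- Ramified trees have bounded threads.
section Ramified

open SimpleGraph

variable {X : Type u} {G : SimpleGraph X}

/-- `u` is a non-backtracking walk during its first `L` steps. -/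
structure NonBacktracking (G : SimpleGraph X) (u : ℕ → X) (L : ℕ) : Prop where
  adj : ∀ i < L, G.Adj (u i) (u (i + 1))
  ne : ∀ i, i + 1 < L → u i ≠ u (i + 2)

theorem nonBacktracking_getVert {x y : X} {p : G.Walk x y} (hp : p.IsPath) {s L : ℕ}
    (h : s + L ≤ p.length) : NonBacktracking G (fun i => p.getVert (s + i)) L where
  adj i hi := p.adj_getVert_succ (by omega)
  ne i hi heq := by
    have := hp.getVert_injOn (by simp; omega) (by simp; omega) heq
    omega

theorem nonBacktracking_getVert_sub {x y : X} {p : G.Walk x y} (hp : p.IsPath) {L : ℕ}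
    (h : L ≤ p.length) : NonBacktracking G (fun i => p.getVert (L - i)) L where
  adj i hi := by
    have := p.adj_getVert_succ (i := L - (i + 1)) (by omega)
    rw [show L - (i + 1) + 1 = L - i by omega] at this
    exact this.symm
  ne i hi heq := by
    have := hp.getVert_injOn (by simp; omega) (by simp; omega) heq
    omega

variable [G.LocallyFinite]

theorem eq_or_eq_of_degree_eq_two {x a b c : X} (hx : G.degree x = 2) (ha : G.Adj x a)
    (hb : G.Adj x b) (hc : G.Adj x c) (hab : a ≠ b) : c = a ∨ c = b := by
  classical
  by_contra! h
  have hsub : ({a, b, c} : Finset X) ⊆ G.neighborFinset x := by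
    intro w hw
    simp only [Finset.mem_insert, Finset.mem_singleton] at hw
    rcases hw with rfl | rfl | rfl <;> simpa
  have := Finset.card_le_card hsub
  rw [Finset.card_eq_three.2 ⟨a, b, c, hab, h.1.symm, h.2.symm, rfl⟩,
    G.card_neighborFinset_eq_degree, hx] at this
  omega

/-- At a vertex of degree 2 a non-backtracking walk has no choice: its next vertex is the neighbour
it did not come from. -/
theorem NonBacktracking.eq_of_degree_eq_two {u v : ℕ → X} {L : ℕ} (hu : NonBacktracking G u L)
    (hv : NonBacktracking G v L) (h0 : u 0 = v 0) (h1 : u 1 = v 1)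
    (hdeg : ∀ i, 0 < i → i < L → G.degree (u i) = 2) {i : ℕ} (hi : i ≤ L) : u i = v i := by
  have key : ∀ i, i + 1 ≤ L → u i = v i ∧ u (i + 1) = v (i + 1) := by
    intro i
    induction i with
    | zero => exact fun _ => ⟨h0, h1⟩
    | succ i ih =>
      intro hi
      obtain ⟨ih0, ih1⟩ := ih (by omega)
      refine ⟨ih1, ?_⟩
      have hc : G.Adj (u (i + 1)) (v (i + 2)) := ih1 ▸ hv.adj (i + 1) (by omega)
      rcases eq_or_eq_of_degree_eq_two (hdeg (i + 1) (by omega) (by omega))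
        (hu.adj i (by omega)).symm (hu.adj (i + 1) (by omega)) hc (hu.ne i (by omega)) with h | h
      · exact absurd (ih0.symm.trans h.symm) (hv.ne i (by omega))
      · exact h.symm
  cases i with
  | zero => exact h0
  | succ i => exact (key i hi).2

/-- Every vertex of degree `2` of a ramified tree is an inner vertex of a branch. -/
theorem IsRamifiedTree.exists_branch {k : ℕ} {D : Set ℕ} (hG : IsRamifiedTree G k D) (hk : 3 ≤ k)
    {v : X} (hv : G.degree v = 2) :
    ∃ (r w : X) (b : G.Walk r w) (i : ℕ), IsBranch G k b ∧ b.length ∈ D ∧ 0 < i ∧ i < b.length ∧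
      b.getVert i = v := by
  classical
  -- Take a ramification `r` nearest to `v`. The geodesic from `r` to `v` then meets no other
  -- ramification, so it follows the branch that leaves `r` in its direction.
  have hex : ∃ d r, G.degree r = k ∧ G.dist r v = d := by
    obtain ⟨r, hr⟩ := hG.exists_ramification
    exact ⟨_, r, hr, rfl⟩
  obtain ⟨r, hr, hd⟩ := Nat.find_spec hex
  have hmin : ∀ r', G.degree r' = k → G.dist r v ≤ G.dist r' v := fun r' hr' =>
    hd ▸ Nat.find_min' hex ⟨r', hr', rfl⟩
  obtain ⟨q, hq, hql⟩ := hG.isTree.connected.exists_path_of_dist r v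
  have hL : 0 < q.length := by
    rw [hql]
    refine hG.isTree.connected.pos_dist_of_ne ?_
    rintro rfl
    omega
  have hinner : ∀ i, 0 < i → i ≤ q.length → G.degree (q.getVert i) = 2 := by
    intro i hi0 hi
    refine (hG.degree _).resolve_right fun hdeg => ?_
    have h1 := hmin _ hdeg
    have h2 := dist_le (q.drop i)
    rw [Walk.drop_length] at h2
    omega
  have hadj : G.Adj r (q.getVert 1) := by
    simpa using q.adj_getVert_succ hL
  obtain ⟨w, b, hb, hb1, hbD⟩ := hG.next_ramification r _ hr hadj
  have hcoin : ∀ i, i ≤ min q.length b.length → q.getVert i = b.getVert i := by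
    intro i hi
    have hqn := nonBacktracking_getVert hq (s := 0) (L := min q.length b.length) (by omega)
    have hbn := nonBacktracking_getVert hb.1 (s := 0) (L := min q.length b.length) (by omega)
    have := hqn.eq_of_degree_eq_two hbn (by simp) (by simpa using hb1.symm)
      (fun i hi0 hi => by rw [zero_add]; exact hinner i hi0 (by omega)) hi
    simpa using this
  have hlt : q.length < b.length := by
    by_contra! hle
    have h1 := hcoin b.length (by omega)
    rw [Walk.getVert_length] at h1
    have h2 := hinner b.length hb.2.1 hle
    rw [h1, hb.2.2.2.1] at h2
    omega
  refine ⟨r, w, b, q.length, hb, hbD, hL, hlt, ?_⟩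
  rw [← hcoin q.length (by omega), Walk.getVert_length]

/-- If the vertices 1, ..., n of a path all had degree 2, vertex 1 would lie inside a branch, at
position j with 0 < j < length ≤ n. The path would be forced along the branch to one of its ends,
reaching degree `k` at index 1 + j or 1 + (length - j), both at most n. -/
theorem IsTreeSecond.boundedThreads {k n : ℕ} (hG : IsTreeSecond G k n) (hk : 3 ≤ k)
    (hn : 0 < n) : BoundedThreads G n := by
  intro y x p hp hlen
  by_contra! hlow
  have htwo : ∀ i, 0 < i → i ≤ n → G.degree (p.getVert i) = 2 := by
    intro i hi0 hi
    have := hlow i hi0 hi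
    rcases hG.degree (p.getVert i) with h | h <;> omega
  obtain ⟨r, w, b, j, hb, hbn, hj0, hj, hv⟩ :=
    IsRamifiedTree.exists_branch hG hk (htwo 1 one_pos hn)
  have hbn : b.length ≤ n := hbn
  obtain ⟨hbp, -, hr, hw, hinner⟩ := hb
  have hpadj : G.Adj (b.getVert j) (p.getVert 2) := hv ▸ p.adj_getVert_succ (by omega)
  have hforw : G.Adj (b.getVert j) (b.getVert (j + 1)) := b.adj_getVert_succ hj
  have hback : G.Adj (b.getVert j) (b.getVert (j - 1)) := by
    have := b.adj_getVert_succ (i := j - 1) (by omega)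
    rw [Nat.sub_add_cancel hj0] at this
    exact this.symm
  have hne : b.getVert (j - 1) ≠ b.getVert (j + 1) := by
    intro heq
    have := hbp.getVert_injOn (by simp; omega) (by simp; omega) heq
    omega
  -- The two cases are the two directions along the branch, back to `r` or on to `w`.
  rcases eq_or_eq_of_degree_eq_two (hinner j hj0 hj) hback hforw hpadj hne with h | h
  · have h1 := nonBacktracking_getVert_sub hbp hj.le
    have h2 := nonBacktracking_getVert hp (s := 1) (L := j) (by omega)
    have := h1.eq_of_degree_eq_two h2 (by simpa using hv) (by simpa using h.symm)
      (fun i hi0 hi => hinner _ (by omega) (by omega)) le_rfl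
    simp only [Nat.sub_self, Walk.getVert_zero] at this
    have h3 := htwo (1 + j) (by omega) (by omega)
    rw [← this, hr] at h3
    omega
  · have h1 := nonBacktracking_getVert hbp (s := j) (L := b.length - j) (by omega)
    have h2 := nonBacktracking_getVert hp (s := 1) (L := b.length - j) (by omega)
    have := h1.eq_of_degree_eq_two h2 (by simpa using hv) (by simpa using h.symm)
      (fun i hi0 hi => hinner _ (by omega) (by omega)) le_rfl
    simp only [Nat.add_sub_cancel' hj.le, Walk.getVert_length] at this
    have h3 := htwo (1 + (b.length - j)) (by omega) (by omega)
    rw [← this, hw] at h3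
    omega

theorem IsTreePrime.isTreeSecond {k n : ℕ} (hG : IsTreePrime G k n) : IsTreeSecond G k n where
  isTree := hG.isTree
  degree := hG.degree
  exists_ramification := hG.exists_ramification
  next_ramification x y hx hxy := by
    obtain ⟨w, p, hp, hp1, hpn⟩ := hG.next_ramification x y hx hxy
    exact ⟨w, p, hp, hp1, (show p.length = n from hpn).le⟩

theorem IsTreeSecond.TOA {k n : ℕ} (hG : IsTreeSecond G k n) (hk : 3 ≤ k) (hn : 0 < n) (o : X) :
    TOA (simpleRW G) (ballLam G o) := by
  refine TOA_of_boundedThreads hG.isTree (fun x => ?_) hn (hG.boundedThreads hk hn)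
    (ballLam_isProbSeq G hG.isTree.connected o)
  rcases hG.degree x with h | h <;> omega

end Ramified
-- Growth of spheres and divergence of parity averages.
section Spheres

open SimpleGraph

variable {X : Type u} {G : SimpleGraph X}

theorem exists_adj_forall_dist_eq (hG : G.IsTree) {o y : X} (hy : y ≠ o) :
    ∃ y', G.Adj y y' ∧ ∀ w, w ≠ y' → G.Adj w y → G.dist o w = G.dist o y + 1 := by
  obtain ⟨y', hadj, -, hother⟩ := exists_parent hG hy
  refine ⟨y', hadj, fun w hw hwy => ?_⟩
  rw [dist_comm, ← length_treePath hG, hother w hw hwy, Walk.length_cons, length_treePath,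
    dist_comm]

variable [G.LocallyFinite]

/-- The closed ball as a finite set. -/
noncomputable def ballFinset (hG : G.IsTree) (o : X) (N : ℕ) : Finset X :=
  (finite_graphBall G hG.connected o N).toFinset

/-- The sphere as a finite set. -/
noncomputable def sphereFinset (hG : G.IsTree) (o : X) (N : ℕ) : Finset X :=
  {x ∈ ballFinset hG o N | G.dist o x = N}

theorem mem_ballFinset (hG : G.IsTree) {o x : X} {N : ℕ} :
    x ∈ ballFinset hG o N ↔ G.dist o x ≤ N := by
  simp [ballFinset, graphBall]

theorem mem_sphereFinset (hG : G.IsTree) {o x : X} {N : ℕ} :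
    x ∈ sphereFinset hG o N ↔ G.dist o x = N := by
  simp only [sphereFinset, Finset.mem_filter, mem_ballFinset]
  omega

theorem sum_ballFinset_succ (hG : G.IsTree) (o : X) (N : ℕ) {M : Type*} [AddCommMonoid M]
    (f : X → M) : ∑ x ∈ ballFinset hG o (N + 1), f x =
      ∑ x ∈ ballFinset hG o N, f x + ∑ x ∈ sphereFinset hG o (N + 1), f x := by
  classical
  rw [← Finset.sum_union]
  · congr 1
    ext x
    simp only [Finset.mem_union, mem_ballFinset, mem_sphereFinset]
    omega
  · rw [Finset.disjoint_left]
    intro x hx hx'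
    rw [mem_ballFinset] at hx
    rw [mem_sphereFinset] at hx'
    omega

theorem card_ballFinset_succ (hG : G.IsTree) (o : X) (N : ℕ) :
    (ballFinset hG o (N + 1)).card =
      (ballFinset hG o N).card + (sphereFinset hG o (N + 1)).card := by
  simpa using sum_ballFinset_succ hG o N fun _ => (1 : ℕ)

/-- Double counting of the edges between consecutive spheres: a vertex has at most one neighbour
closer to `o`, hence at least `d` farther away. -/
theorem card_sphereFinset_mul_le (hG : G.IsTree) {o : X} {i d : ℕ}
    (hd : ∀ x, G.dist o x = i → d + 1 ≤ G.degree x) :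
    (sphereFinset hG o i).card * d ≤ (sphereFinset hG o (i + 1)).card := by
  classical
  rw [← mul_one (sphereFinset hG o (i + 1)).card]
  refine Finset.card_mul_le_card_mul G.Adj (fun a ha => ?_) fun b hb => ?_
  · rw [mem_sphereFinset] at ha
    have hda := hd a ha
    by_cases hao : a = o
    · subst hao
      refine le_trans (show d ≤ (G.neighborFinset a).card by
        rw [G.card_neighborFinset_eq_degree]; omega) (Finset.card_le_card fun w hw => ?_)
      have hw' : G.Adj a w := by simpa using hw
      rw [SimpleGraph.dist_self] at ha
      rw [Finset.mem_bipartiteAbove, mem_sphereFinset, ← ha, dist_eq_one_iff_adj.2 hw']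
      exact ⟨rfl, hw'⟩
    · obtain ⟨a', hadj, hother⟩ := exists_adj_forall_dist_eq hG hao
      have ha' : a' ∈ G.neighborFinset a := by simpa using hadj
      refine le_trans (show d ≤ ((G.neighborFinset a).erase a').card by
        rw [Finset.card_erase_of_mem ha', G.card_neighborFinset_eq_degree]; omega)
        (Finset.card_le_card fun w hw => ?_)
      obtain ⟨hne, hw⟩ := Finset.mem_erase.1 hw
      have hw' : G.Adj a w := by simpa using hw
      rw [Finset.mem_bipartiteAbove, mem_sphereFinset, hother w hne hw'.symm, ha]
      exact ⟨rfl, hw'⟩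
  · rw [mem_sphereFinset] at hb
    have hbo : b ≠ o := by
      rintro rfl
      simp at hb
    obtain ⟨b', -, hother⟩ := exists_adj_forall_dist_eq hG hbo
    refine Finset.card_le_one.2 fun w hw w' hw' => ?_
    have key : ∀ w ∈ Finset.bipartiteBelow G.Adj (sphereFinset hG o i) b, w = b' := by
      intro w hw
      rw [Finset.mem_bipartiteBelow, mem_sphereFinset] at hw
      by_contra hne
      have := hother w hne hw.2
      omega
    rw [key w hw, key w' hw']

/-- Two-step exponential growth of the spheres makes them comparable with the balls. -/
theorem card_ballFinset_le (hG : G.IsTree) {o : X}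
    (h1 : ∀ i, (sphereFinset hG o i).card ≤ (sphereFinset hG o (i + 1)).card)
    (h2 : ∀ i, 2 * (sphereFinset hG o i).card ≤ (sphereFinset hG o (i + 2)).card) (N : ℕ) :
    (ballFinset hG o N).card ≤ 4 * (sphereFinset hG o N).card := by
  have h0 : (ballFinset hG o 0).card = (sphereFinset hG o 0).card := by
    congr 1
    ext x
    simp [mem_ballFinset, mem_sphereFinset]
  induction N using Nat.twoStepInduction with
  | zero => omega
  | one =>
    have := card_ballFinset_succ hG o 0
    have := h1 0
    simp only [zero_add] at *
    omega
  -- The constant 4 reproduces itself: B(N+2) = B(N) + S(N+1) + S(N+2) ≤ 4 S(N) + 2 S(N+2) ≤ 4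
  -- S(N+2).
  | more N ih _ =>
    have e1 := card_ballFinset_succ hG o N
    have e2 := card_ballFinset_succ hG o (N + 1)
    have := h1 (N + 1)
    have := h2 N
    simp only [add_assoc, one_add_one_eq_two] at *
    omega

/-- A function with distinct values at even and at odd distance from `o` has no average along the
balls of a tree whose spheres are comparable with the balls. -/
theorem not_inDomain_of_parity (hG : G.IsTree) {o : X}
    (hB : ∀ N, (ballFinset hG o N).card ≤ 4 * (sphereFinset hG o N).card) {f : X → ℝ} {c : ℕ → ℝ}
    (hf : ∀ x, f x = c (G.dist o x)) {c₀ c₁ : ℝ} (hne : c₀ ≠ c₁) (h0 : ∀ i, c (2 * i) = c₀)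
    (h1 : ∀ i, c (2 * i + 1) = c₁) : ¬ InDomain (ballLam G o) f := by
  rintro ⟨-, l, hl⟩
  set A := average (ballLam G o) f with hA
  have hAB : ∀ N, A N * (ballFinset hG o N).card = ∑ x ∈ ballFinset hG o N, f x := by
    intro N
    have := average_ballLam_mul_ncard G hG.connected o f N
    rwa [Set.ncard_eq_toFinset_card _ (finite_graphBall G hG.connected o N)] at this
  -- The new average is a convex combination of the old one and the value on the new sphere, whose
  -- share is at least 1/4. Convergence of the averages would thus force `c` to converge to the same
  -- limit.
  have hrec : ∀ N, (A (N + 1) - A N) * (ballFinset hG o (N + 1)).card =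
      (c (N + 1) - A N) * (sphereFinset hG o (N + 1)).card := by
    intro N
    have hs : ∑ x ∈ sphereFinset hG o (N + 1), f x =
        c (N + 1) * (sphereFinset hG o (N + 1)).card := by
      rw [Finset.sum_congr rfl (g := fun _ => c (N + 1)) fun x hx => by
        rw [hf, (mem_sphereFinset hG).1 hx], Finset.sum_const, nsmul_eq_mul, mul_comm]
    have hsum := sum_ballFinset_succ hG o N f
    rw [hs, ← hAB, ← hAB] at hsum
    have hcard : ((ballFinset hG o (N + 1)).card : ℝ) =
        (ballFinset hG o N).card + (sphereFinset hG o (N + 1)).card := by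
      exact_mod_cast card_ballFinset_succ hG o N
    rw [sub_mul, hsum, hcard]
    ring
  have hbound : ∀ N, |c (N + 1) - A N| ≤ 4 * |A (N + 1) - A N| := by
    intro N
    have hpos : 0 < (ballFinset hG o (N + 1)).card :=
      Finset.card_pos.2 ⟨o, (mem_ballFinset hG).2 (by simp)⟩
    have hS : (0 : ℝ) < (sphereFinset hG o (N + 1)).card := by
      have := hB (N + 1)
      exact_mod_cast (by omega : 0 < (sphereFinset hG o (N + 1)).card)
    have hBr : ((ballFinset hG o (N + 1)).card : ℝ) ≤ 4 * (sphereFinset hG o (N + 1)).card := by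
      exact_mod_cast hB (N + 1)
    have habs := congrArg abs (hrec N)
    rw [abs_mul, abs_mul, Nat.abs_cast, Nat.abs_cast] at habs
    refine le_of_mul_le_mul_right ?_ hS
    rw [← habs]
    nlinarith [mul_le_mul_of_nonneg_left hBr (abs_nonneg (A (N + 1) - A N))]
  have hl1 : Tendsto (fun N => A (N + 1)) atTop (𝓝 l) := (tendsto_add_atTop_iff_nat 1).2 hl
  have hdiff : Tendsto (fun N => 4 * |A (N + 1) - A N|) atTop (𝓝 0) := by
    simpa using ((hl1.sub hl).abs.const_mul 4)
  have hc : Tendsto (fun N => c (N + 1)) atTop (𝓝 l) := by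
    have h := (squeeze_zero_norm hbound hdiff).add hl
    simpa using h
  have hc' : Tendsto c atTop (𝓝 l) := (tendsto_add_atTop_iff_nat 1).1 hc
  have hev : Tendsto (fun i : ℕ => 2 * i) atTop atTop :=
    tendsto_atTop_mono (fun i => by simp only [id]; omega) tendsto_id
  have hodd : Tendsto (fun i : ℕ => 2 * i + 1) atTop atTop :=
    tendsto_atTop_mono (fun i => by simp only [id]; omega) tendsto_id
  have e0 := hc'.comp hev
  have e1 := hc'.comp hodd
  simp only [Function.comp_def, h0, h1] at e0 e1
  exact hne ((tendsto_const_nhds_iff.1 e0).trans (tendsto_const_nhds_iff.1 e1).symm)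

end Spheres

/-! ### Generating functions on bihomogeneous trees. -/

section Bihomogeneous

open SimpleGraph

variable {X : Type u} {G : SimpleGraph X} [G.LocallyFinite] {m n : ℕ}

theorem IsBihomogeneousTree.symm (hG : IsBihomogeneousTree G m n) : IsBihomogeneousTree G n m where
  isTree := hG.isTree
  degree x := (hG.degree x).symm
  adj_left := hG.adj_right
  adj_right := hG.adj_left

/-- Since m ≠ n are both at least 2, one of any two adjacent vertices has degree at least 3. -/
theorem IsBihomogeneousTree.boundedThreads (hG : IsBihomogeneousTree G m n) (hm : 2 ≤ m)
    (hn : 2 ≤ n) (hmn : m ≠ n) : BoundedThreads G 2 := by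
  intro y x p _ hlen
  have hadj := p.adj_getVert_succ (i := 1) (by omega)
  rcases hG.degree (p.getVert 1) with h | h
  · have := hG.adj_left _ _ hadj h
    rcases Nat.lt_or_ge m 3 with h3 | h3
    · exact ⟨2, by omega, le_rfl, by rw [this]; omega⟩
    · exact ⟨1, by omega, by omega, by rwa [h]⟩
  · have := hG.adj_right _ _ hadj h
    rcases Nat.lt_or_ge n 3 with h3 | h3
    · exact ⟨2, by omega, le_rfl, by rw [this]; omega⟩
    · exact ⟨1, by omega, by omega, by rwa [h]⟩

theorem IsBihomogeneousTree.two_le_degree (hG : IsBihomogeneousTree G m n) (hm : 2 ≤ m)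
    (hn : 2 ≤ n) (x : X) : 2 ≤ G.degree x := by
  rcases hG.degree x with h | h <;> omega

theorem IsBihomogeneousTree.degree_start (hG : IsBihomogeneousTree G m n) {y x : X}
    (hx : G.degree x = n) (p : G.Walk y x) :
    G.degree y = if Even p.length then n else m := by
  induction p with
  | nil => simpa using hx
  | @cons u v w h p ih =>
    have ih := ih hx
    rw [Walk.length_cons]
    by_cases he : Even p.length
    · rw [if_pos he] at ih
      rw [if_neg (by simpa [Nat.even_add_one] using he)]
      exact hG.adj_right _ _ h.symm ih
    · rw [if_neg he] at ih
      rw [if_pos (by simpa [Nat.even_add_one] using he)]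
      exact hG.adj_left _ _ h.symm ih

theorem IsBihomogeneousTree.degree_eq (hG : IsBihomogeneousTree G m n) {o : X}
    (ho : G.degree o = n) (y : X) : G.degree y = if Even (G.dist o y) then n else m := by
  rw [hG.degree_start ho (treePath hG.isTree y o), length_treePath, SimpleGraph.dist_comm]

theorem IsBihomogeneousTree.card_ballFinset_le (hG : IsBihomogeneousTree G m n) (hm : 2 ≤ m)
    (hn : 2 ≤ n) (hmn : m ≠ n) {o : X} (ho : G.degree o = n) (N : ℕ) :
    (ballFinset hG.isTree o N).card ≤ 4 * (sphereFinset hG.isTree o N).card := by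
  refine AvgRW.card_ballFinset_le hG.isTree (fun i => ?_) (fun i => ?_) N
  · have := card_sphereFinset_mul_le hG.isTree (o := o) (i := i) (d := 1)
      fun x _ => hG.two_le_degree hm hn x
    omega
  · have key : ∀ i, (sphereFinset hG.isTree o i).card * ((if Even i then n else m) - 1) ≤
        (sphereFinset hG.isTree o (i + 1)).card := by
      intro i
      refine card_sphereFinset_mul_le hG.isTree fun x hx => ?_
      rw [hG.degree_eq ho x, hx]
      split_ifs <;> omega
    have h1 := key i
    have h2 := key (i + 1)
    have hprod : 2 ≤ ((if Even i then n else m) - 1) * ((if Even (i + 1) then n else m) - 1) := by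
      -- Over two steps the spheres grow by the factor (m - 1)(n - 1), which is at least 2 because
      -- the degrees differ.
      have h3 : ∀ a b : ℕ, 2 ≤ a → 2 ≤ b → a ≠ b → 2 ≤ (a - 1) * (b - 1) := by
        intro a b ha hb hab
        rcases Nat.lt_or_ge a 3 with h | h
        · exact (show 2 ≤ b - 1 by omega).trans (Nat.le_mul_of_pos_left _ (by omega))
        · exact (show 2 ≤ a - 1 by omega).trans (Nat.le_mul_of_pos_right _ (by omega))
      by_cases he : Even i
      · simpa [he, Nat.even_add_one] using h3 n m hn hm hmn.symm
      · simpa [he, Nat.even_add_one] using h3 m n hm hn hmn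
    calc 2 * (sphereFinset hG.isTree o i).card
        ≤ ((if Even i then n else m) - 1) * ((if Even (i + 1) then n else m) - 1) *
          (sphereFinset hG.isTree o i).card := Nat.mul_le_mul_right _ hprod
      _ = (sphereFinset hG.isTree o i).card * ((if Even i then n else m) - 1) *
          ((if Even (i + 1) then n else m) - 1) := by ring
      _ ≤ (sphereFinset hG.isTree o (i + 1)).card * ((if Even (i + 1) then n else m) - 1) :=
        Nat.mul_le_mul_right _ h1
      _ ≤ _ := h2

/-- The hitting generating functions of a bihomogeneous tree are alternating products of the two
one-step ones, `a` and `b`. -/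
theorem IsBihomogeneousTree.genF_eq (hG : IsBihomogeneousTree G m n) (hm : 2 ≤ m) (hn : 2 ≤ n)
    {x : X} (hx : G.degree x = n) {z a b : ℝ} (hz0 : 0 ≤ z) (hz1 : z < 1) (ha0 : 0 ≤ a)
    (ha1 : a ≤ 1) (hb0 : 0 ≤ b) (hb1 : b ≤ 1) (ha : m * a = z * (1 + (m - 1) * (a * b)))
    (hb : n * b = z * (1 + (n - 1) * (a * b))) : genF (simpleRW G) x x z = z * a := by
  -- Here `a` belongs to a step from degree `m` to degree `n` and `b` to the reverse one. From
  -- distance `j` to `x` the hitting function is the product of `j` alternating factors ending in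
  -- `a`, as every neighbour of `x` has degree `m`.
  set g : ℕ → ℝ := fun j => (a * b) ^ (j / 2) * if Even j then 1 else a with hg
  have hab0 : 0 ≤ a * b := mul_nonneg ha0 hb0
  have hab1 : a * b ≤ 1 := mul_le_one₀ ha1 hb0 hb1
  have hpos : ∀ y, 0 < G.degree y := fun y => two_pos.trans_le (hG.two_le_degree hm hn y)
  have hge : ∀ i, g (2 * i) = (a * b) ^ i := fun i => by simp [hg]
  have hgo : ∀ i, g (2 * i + 1) = (a * b) ^ i * a := by
    intro i
    simp only [hg]
    rw [if_neg (by simp), show (2 * i + 1) / 2 = i by omega]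
  have hg0 : ∀ j, 0 ≤ g j := by
    intro j
    simp only [hg]
    split_ifs <;> positivity
  have hg1 : ∀ j, g j ≤ 1 := by
    intro j
    simp only [hg]
    refine mul_le_one₀ (pow_le_one₀ hab0 hab1) ?_ ?_ <;> split_ifs <;>
      first | positivity | exact le_rfl | exact ha1
  have hsol : ∀ y, y ≠ x → z * ∑ w ∈ G.neighborFinset y, g (treePath hG.isTree w x).length =
      G.degree y * g (treePath hG.isTree y x).length := by
    intro y hy
    obtain ⟨y', hadj, hpath, hother⟩ := exists_parent hG.isTree hy
    have hdeg := hG.degree_start hx (treePath hG.isTree y x)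
    have hl : (treePath hG.isTree y x).length = (treePath hG.isTree y' x).length + 1 := by
      rw [hpath, Walk.length_cons]
    have hsum := sum_neighborFinset_eq (φ := fun y => g (treePath hG.isTree y x).length)
      (c := g ((treePath hG.isTree y x).length + 1)) hadj
      fun w hw hwy => by rw [hother w hw hwy, Walk.length_cons]
    rw [hsum]
    simp only [hl] at hdeg ⊢
    generalize (treePath hG.isTree y' x).length = j at hdeg
    rcases Nat.even_or_odd' j with ⟨i, rfl | rfl⟩
    · rw [if_neg (by simp)] at hdeg
      rw [hdeg, hgo, hge, show 2 * i + 1 + 1 = 2 * (i + 1) by ring, hge, pow_succ]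
      linear_combination (-(a * b) ^ i) * ha
    · rw [if_pos (by simp [Nat.even_add_one])] at hdeg
      rw [hdeg, hgo, show 2 * i + 1 + 1 = 2 * (i + 1) by ring, hge, hgo, pow_succ]
      linear_combination (-(a * b) ^ i * a) * hb
  rw [genF_eq_of_solution G hz0 hz1 (fun y => hg0 _) (fun y => hg1 _)
    (by simpa [treePath_self] using hge 0) hpos hsol,
    Finset.sum_congr rfl (g := fun _ => a) fun w hw => ?_, Finset.sum_const,
    G.card_neighborFinset_eq_degree, nsmul_eq_mul]
  · have : (G.degree x : ℝ) ≠ 0 := by exact_mod_cast (hpos x).ne'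
    field_simp
  · have hw' : G.Adj w x := by simpa [adj_comm] using hw
    rw [treePath_of_adj hG.isTree hw', treePath_self]
    simpa using hgo 0

/-- The product p = ab must satisfy mnp = z²(1 + (m-1)p)(1 + (n-1)p). The difference of the two
sides is -z² at p = 0 and mn(1 - z²) at p = 1, so a root lies in [0,1]. Which root is immaterial:
for z < 1 bounded solutions are unique. -/
theorem exists_hitting_solution (hm : 2 ≤ m) (hn : 2 ≤ n) {z : ℝ} (hz0 : 0 ≤ z) (hz1 : z ≤ 1) :
    ∃ a b : ℝ, 0 ≤ a ∧ a ≤ 1 ∧ 0 ≤ b ∧ b ≤ 1 ∧ m * a = z * (1 + (m - 1) * (a * b)) ∧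
      n * b = z * (1 + (n - 1) * (a * b)) := by
  have hm' : (2 : ℝ) ≤ m := by exact_mod_cast hm
  have hn' : (2 : ℝ) ≤ n := by exact_mod_cast hn
  have hm0 : (m : ℝ) ≠ 0 := by positivity
  have hn0 : (n : ℝ) ≠ 0 := by positivity
  set g : ℝ → ℝ := fun p => m * n * p - z ^ 2 * ((1 + (m - 1) * p) * (1 + (n - 1) * p)) with hg
  have hcont : ContinuousOn g (Set.Icc 0 1) := by
    simp only [hg]
    fun_prop
  have hzz : z ^ 2 ≤ 1 := pow_le_one₀ hz0 hz1
  have hmem : (0 : ℝ) ∈ Set.Icc (g 0) (g 1) := by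
    constructor
    · simp only [hg]
      nlinarith [sq_nonneg z]
    · simp only [hg]
      nlinarith [mul_pos (show (0 : ℝ) < m by linarith) (show (0 : ℝ) < n by linarith)]
  obtain ⟨p, ⟨hp0, hp1⟩, hp⟩ := intermediate_value_Icc zero_le_one hcont hmem
  have hbd : ∀ d : ℝ, 2 ≤ d → 0 ≤ z * (1 + (d - 1) * p) / d ∧ z * (1 + (d - 1) * p) / d ≤ 1 := by
    intro d hd
    have h1 : 0 ≤ (d - 1) * p := mul_nonneg (by linarith) hp0
    have h2 : (d - 1) * p ≤ d - 1 := mul_le_of_le_one_right (by linarith) hp1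
    refine ⟨by positivity, (div_le_one (by linarith)).2 ?_⟩
    exact (mul_le_of_le_one_left (by linarith) hz1).trans (by linarith)
  have hab : z * (1 + (m - 1) * p) / m * (z * (1 + (n - 1) * p) / n) = p := by
    rw [div_mul_div_comm, div_eq_iff (by positivity)]
    simp only [hg] at hp
    linear_combination -hp
  refine ⟨_, _, (hbd m hm').1, (hbd m hm').2, (hbd n hn').1, (hbd n hn').2, ?_, ?_⟩
  · rw [hab]
    field_simp
  · rw [hab]
    field_simp

theorem IsBihomogeneousTree.tendsto_genF (hG : IsBihomogeneousTree G m n) (hm : 2 ≤ m)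
    (hn : 2 ≤ n) (hmn : m ≠ n) (x : X) :
    Tendsto (fun z => genF (simpleRW G) x x z) (𝓝[<] 1) (𝓝 (genF (simpleRW G) x x 1)) :=
  tendsto_genF_nhdsLT_one G (genF_one_le_of_boundedThreads hG.isTree (hG.two_le_degree hm hn)
    two_pos (hG.boundedThreads hm hn hmn) x).1

theorem IsBihomogeneousTree.genF_congr (hG : IsBihomogeneousTree G m n) (hm : 2 ≤ m)
    (hn : 2 ≤ n) (hmn : m ≠ n) {x y : X} (hx : G.degree x = n) (hy : G.degree y = n) {z : ℝ}
    (hz0 : 0 < z) (hz1 : z ≤ 1) : genF (simpleRW G) x x z = genF (simpleRW G) y y z := by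
  have hlt : ∀ z : ℝ, 0 < z → z < 1 → genF (simpleRW G) x x z = genF (simpleRW G) y y z := by
    intro z hz0 hz1
    obtain ⟨a, b, ha0, ha1, hb0, hb1, ha, hb⟩ := exists_hitting_solution hm hn hz0.le hz1.le
    rw [hG.genF_eq hm hn hx hz0.le hz1 ha0 ha1 hb0 hb1 ha hb,
      hG.genF_eq hm hn hy hz0.le hz1 ha0 ha1 hb0 hb1 ha hb]
  rcases hz1.lt_or_eq with h | rfl
  · exact hlt z hz0 h
  · refine tendsto_nhds_unique (hG.tendsto_genF hm hn hmn x)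
      ((hG.tendsto_genF hm hn hmn y).congr' ?_)
    filter_upwards [Ioo_mem_nhdsLT (zero_lt_one (α := ℝ))] with z hz
    exact (hlt z hz.1 hz.2).symm

/-- The equation relating the return generating functions at the two kinds of vertices. -/
theorem IsBihomogeneousTree.genF_relation (hG : IsBihomogeneousTree G m n) (hm : 2 ≤ m)
    (hn : 2 ≤ n) (hmn : m ≠ n) {x y : X} (hx : G.degree x = n) (hy : G.degree y = m) {z : ℝ}
    (hz0 : 0 < z) (hz1 : z ≤ 1) :
    m * genF (simpleRW G) x x z =
      z ^ 2 + (m - 1) * (genF (simpleRW G) x x z * genF (simpleRW G) y y z) := by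
  have hlt : ∀ z : ℝ, 0 < z → z < 1 → m * genF (simpleRW G) x x z =
      z ^ 2 + (m - 1) * (genF (simpleRW G) x x z * genF (simpleRW G) y y z) := by
    intro z hz0 hz1
    obtain ⟨a, b, ha0, ha1, hb0, hb1, ha, hb⟩ := exists_hitting_solution hm hn hz0.le hz1.le
    rw [hG.genF_eq hm hn hx hz0.le hz1 ha0 ha1 hb0 hb1 ha hb,
      hG.symm.genF_eq hn hm hy hz0.le hz1 hb0 hb1 ha0 ha1 (by rwa [mul_comm b]) (by rwa [mul_comm b])]
    linear_combination z * ha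
  rcases hz1.lt_or_eq with h | rfl
  · exact hlt z hz0 h
  · have hX := hG.tendsto_genF hm hn hmn x
    have hY := hG.tendsto_genF hm hn hmn y
    have hz : Tendsto (fun z : ℝ => z ^ 2) (𝓝[<] 1) (𝓝 (1 ^ 2)) :=
      ((continuous_pow 2).tendsto 1).mono_left nhdsWithin_le_nhds
    refine tendsto_nhds_unique (hX.const_mul (m : ℝ))
      ((hz.add ((hX.mul hY).const_mul ((m : ℝ) - 1))).congr' ?_)
    filter_upwards [Ioo_mem_nhdsLT (zero_lt_one (α := ℝ))] with z hz
    exact (hlt z hz.1 hz.2).symm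

/-- If both values were `s`, subtracting the two relations would give (m - n) s (1 - s) = 0. Then s
= 0 forces z = 0, while s = 1 forces z = 1 and contradicts transience. -/
theorem IsBihomogeneousTree.genF_ne (hG : IsBihomogeneousTree G m n) (hm : 2 ≤ m)
    (hn : 2 ≤ n) (hmn : m ≠ n) {x y : X} (hx : G.degree x = n) (hy : G.degree y = m) {z : ℝ}
    (hz0 : 0 < z) (hz1 : z ≤ 1) : genF (simpleRW G) x x z ≠ genF (simpleRW G) y y z := by
  intro heq
  have h1 := hG.genF_relation hm hn hmn hx hy hz0 hz1
  have h2 := hG.symm.genF_relation hn hm hmn.symm hy hx hz0 hz1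
  have hone : genF (simpleRW G) x x 1 < 1 := by
    have := (genF_one_le_of_boundedThreads hG.isTree (hG.two_le_degree hm hn) two_pos
      (hG.boundedThreads hm hn hmn) x).2
    norm_num at this
    linarith
  rw [← heq] at h1 h2
  set s := genF (simpleRW G) x x z with hs
  have hmn' : (m : ℝ) - n ≠ 0 := sub_ne_zero.2 (by exact_mod_cast hmn)
  have h3 : s * (1 - s) = 0 := by
    refine (mul_eq_zero.1 (?_ : ((m : ℝ) - n) * (s * (1 - s)) = 0)).resolve_left hmn'
    linear_combination h1 - h2
  rcases mul_eq_zero.1 h3 with h | h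
  · rw [h] at h1
    have : 0 < z ^ 2 := by positivity
    linarith
  · have hs1 : s = 1 := by linarith
    rw [hs1] at h1
    have hz : z = 1 := by
      have : z ^ 2 = 1 := by linarith
      nlinarith
    rw [hz] at hs
    linarith

theorem IsBihomogeneousTree.not_inDomain (hG : IsBihomogeneousTree G m n) (hm : 2 ≤ m)
    (hn : 2 ≤ n) (hmn : m ≠ n) (o : X) {z : ℝ} (hz0 : 0 < z) (hz1 : z ≤ 1) :
    ¬ InDomain (ballLam G o) fun x => genF (simpleRW G) x x z := by
  wlog ho : G.degree o = n generalizing m n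
  · exact this hG.symm hn hm hmn.symm ((hG.degree o).resolve_right ho)
  obtain ⟨y, hy⟩ : ∃ y, G.Adj o y :=
    (G.degree_pos_iff_exists_adj o).1 (two_pos.trans_le (hG.two_le_degree hm hn o))
  have hydeg : G.degree y = m := hG.adj_right _ _ hy ho
  refine not_inDomain_of_parity hG.isTree (hG.card_ballFinset_le hm hn hmn ho)
    (c := fun i => if Even i then genF (simpleRW G) o o z else genF (simpleRW G) y y z)
    (fun x => ?_) (hG.genF_ne hm hn hmn ho hydeg hz0 hz1) (fun i => by simp)
    (fun i => by simp)
  have hdeg := hG.degree_eq ho x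
  split_ifs at hdeg ⊢ with he
  · exact hG.genF_congr hm hn hmn hdeg ho hz0 hz1
  · exact hG.symm.genF_congr hn hm hmn.symm hdeg hydeg hz0 hz1

theorem IsBihomogeneousTree.not_thermoAdmissible (hG : IsBihomogeneousTree G m n) (hm : 2 ≤ m)
    (hn : 2 ≤ n) (hmn : m ≠ n) (o : X) : ¬ ThermoAdmissible (simpleRW G) (ballLam G o) := by
  rintro ⟨ε, hε, h⟩
  obtain ⟨z, hz⟩ := exists_between hε.2
  exact hG.not_inDomain hm hn hmn o (hε.1.trans hz.1) hz.2.le (h z hz)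

theorem IsBihomogeneousTree.TOA (hG : IsBihomogeneousTree G m n) (hm : 2 ≤ m) (hn : 2 ≤ n)
    (hmn : m ≠ n) {lam : ℕ → X → ℝ} (hlam : IsProbSeq lam) : TOA (simpleRW G) lam :=
  TOA_of_boundedThreads hG.isTree (hG.two_le_degree hm hn) two_pos (hG.boundedThreads hm hn hmn) hlam

end Bihomogeneous
-- An explicit bihomogeneous tree on ℕ.
section ParentGraph

open SimpleGraph

/-- The graph on `ℕ` in which every `x > 0` is joined to its parent `par x`. -/
def parentGraph (par : ℕ → ℕ) (hpar : ∀ x, 0 < x → par x < x) : SimpleGraph ℕ where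
  Adj a b := (0 < a ∧ par a = b) ∨ (0 < b ∧ par b = a)
  symm := ⟨fun _ _ h => h.symm⟩
  loopless := ⟨fun a h => by
    rcases h with ⟨h, h'⟩ | ⟨h, h'⟩ <;> exact absurd h' (hpar a h).ne⟩

variable {par : ℕ → ℕ} {hpar : ∀ x, 0 < x → par x < x}

theorem parentGraph_isTree : (parentGraph par hpar).IsTree where
  connected := by
    have key : ∀ x, (parentGraph par hpar).Reachable x 0 := by
      intro x
      induction x using Nat.strong_induction_on with
      | _ x ih =>
        rcases Nat.eq_zero_or_pos x with rfl | hx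
        · rfl
        · have hadj : (parentGraph par hpar).Adj x (par x) := Or.inl ⟨hx, rfl⟩
          exact hadj.reachable.trans (ih _ (hpar x hx))
    exact ⟨fun x y => (key x).trans (key y).symm⟩
  -- The largest vertex of a cycle can only be joined within the cycle to its parent, so its two
  -- cycle neighbours would coincide.
  isAcyclic := by
    intro v c hc
    obtain ⟨M, hM, hmax⟩ := c.support.toFinset.exists_max_image id ⟨v, by simp⟩
    rw [List.mem_toFinset] at hM
    have hc' : (c.rotate M hM).IsCycle := (Walk.isCycle_rotate hM).2 hc
    have hle : ∀ w ∈ (c.rotate M hM).support, w ≤ M := fun w hw =>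
      hmax w (List.mem_toFinset.2 ((Walk.mem_support_rotate_iff c M hM).1 hw))
    have hpar_eq : ∀ w ∈ (c.rotate M hM).support, (parentGraph par hpar).Adj M w → w = par M := by
      intro w hw hadj
      rcases hadj with ⟨-, h⟩ | ⟨h0, h⟩
      · exact h.symm
      · have := hpar w h0
        have := hle w hw
        omega
    have hnil := hc'.not_nil
    refine hc'.snd_ne_penultimate ?_
    have h1 := hpar_eq _ (Walk.getVert_mem_support _ _) (Walk.adj_snd hnil)
    have h2 := hpar_eq _ (Walk.getVert_mem_support _ _) (Walk.adj_penultimate hnil).symm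
    exact h1.trans h2.symm

/-- A model of the tree `𝕋_{2,3}`: the even numbers have degree `3`, the odd ones degree `2`. -/
def treeTwoThree : SimpleGraph ℕ :=
  -- An even `x` has the odd children 2x + 3 and 2x + 5, an odd `x` the single child x + 1.
  -- Truncated subtraction makes 1 a third child of the root 0, which has no parent.
  parentGraph (fun x => if x % 2 = 0 then x - 1 else 2 * (((x + 1) / 2 - 2) / 2))
    fun x hx => by split_ifs <;> omega

theorem neighborSet_treeTwoThree (x : ℕ) : treeTwoThree.neighborSet x =
    if x % 2 = 0 then (({if x = 0 then 1 else x - 1, 2 * x + 3, 2 * x + 5} : Finset ℕ) : Set ℕ)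
    else (({x + 1, 2 * (((x + 1) / 2 - 2) / 2)} : Finset ℕ) : Set ℕ) := by
  ext y
  rw [mem_neighborSet]
  simp only [treeTwoThree, parentGraph]
  split_ifs <;>
    simp only [Finset.coe_insert, Finset.coe_singleton, Set.mem_insert_iff,
      Set.mem_singleton_iff] <;> omega

noncomputable instance : treeTwoThree.LocallyFinite := fun x =>
  Set.Finite.fintype (by
    rw [neighborSet_treeTwoThree]
    split_ifs <;> exact Finset.finite_toSet _)

theorem degree_treeTwoThree (x : ℕ) : treeTwoThree.degree x = if x % 2 = 0 then 3 else 2 := by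
  rw [← card_neighborSet_eq_degree, ← Nat.card_eq_fintype_card, Nat.card_coe_set_eq,
    neighborSet_treeTwoThree]
  split_ifs with h h0
  · subst h0
    rw [Set.ncard_coe_finset]
    rfl
  · rw [Set.ncard_coe_finset]
    exact Finset.card_eq_three.2 ⟨_, _, _, by omega, by omega, by omega, rfl⟩
  · rw [Set.ncard_coe_finset]
    exact Finset.card_pair (by omega)

theorem treeTwoThree_isBihomogeneousTree : IsBihomogeneousTree treeTwoThree 2 3 := by
  have hparity : ∀ x y, treeTwoThree.Adj x y → (x + y) % 2 = 1 := by
    intro x y hxy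
    simp only [treeTwoThree, parentGraph] at hxy
    split_ifs at hxy <;> omega
  refine ⟨parentGraph_isTree, fun x => ?_, fun x y hxy hx => ?_, fun x y hxy hx => ?_⟩
  · rw [degree_treeTwoThree]
    split_ifs <;> simp
  all_goals
    have := hparity x y hxy
    rw [degree_treeTwoThree] at hx ⊢
    split_ifs at hx ⊢ <;> omega

end ParentGraph
end AvgRW

theorem mainTheorem11 :
    -- bihomogeneous trees
    (∀ (X : Type u) (G : SimpleGraph X) [G.LocallyFinite] (m n : ℕ),
      2 ≤ m → 2 ≤ n → m ≠ n → AvgRW.IsBihomogeneousTree G m n →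
        (∀ lam : ℕ → X → ℝ, AvgRW.IsProbSeq lam → AvgRW.TOA (AvgRW.simpleRW G) lam) ∧
        ∀ o : X,
          AvgRW.TOA (AvgRW.simpleRW G) (AvgRW.ballLam G o) ∧
          ¬ AvgRW.InDomain (AvgRW.ballLam G o) (fun x => AvgRW.genF (AvgRW.simpleRW G) x x 1) ∧
          ¬ AvgRW.ROAt (AvgRW.simpleRW G) (AvgRW.ballLam G o) ∧
          ¬ AvgRW.TOAt (AvgRW.simpleRW G) (AvgRW.ballLam G o)) ∧
    -- the thermodynamical classification is not complete
    (∃ (X : Type) (G : SimpleGraph X) (P : X → X → ℝ) (o : X),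
      Infinite X ∧ G.Connected ∧ (∀ x, (G.neighborSet x).Finite) ∧ AvgRW.IsRandomWalk P ∧
        ¬ AvgRW.ROAt P (AvgRW.ballLam G o) ∧ ¬ AvgRW.TOAt P (AvgRW.ballLam G o)) ∧
    -- the trees with equally spaced ramifications
    (∀ (X : Type u) (G : SimpleGraph X) [G.LocallyFinite] (k n : ℕ),
      3 ≤ k → 2 ≤ n → AvgRW.IsTreePrime G k n →
        ∀ o : X, AvgRW.TOA (AvgRW.simpleRW G) (AvgRW.ballLam G o)) ∧
    -- the trees with boundedly spaced ramifications
    (∀ (X : Type u) (G : SimpleGraph X) [G.LocallyFinite] (k n : ℕ),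
      3 ≤ k → 2 ≤ n → AvgRW.IsTreeSecond G k n →
        ∀ o : X, AvgRW.TOA (AvgRW.simpleRW G) (AvgRW.ballLam G o)) := by
  refine ⟨fun X G _ m n hm hn hmn hG => ?_, ?_, fun X G _ k n hk hn hG o => ?_,
    fun X G _ k n hk hn hG o => ?_⟩
  · refine ⟨fun lam hlam => hG.TOA hm hn hmn hlam, fun o => ?_⟩
    have hadm := hG.not_thermoAdmissible hm hn hmn o
    exact ⟨hG.TOA hm hn hmn (AvgRW.ballLam_isProbSeq G hG.isTree.connected o),
      hG.not_inDomain hm hn hmn o one_pos le_rfl, fun h => hadm h.1, fun h => hadm h.1⟩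
  · have hG := AvgRW.treeTwoThree_isBihomogeneousTree
    have hadm := hG.not_thermoAdmissible le_rfl (by norm_num) (by norm_num) 0
    exact ⟨ℕ, AvgRW.treeTwoThree, AvgRW.simpleRW AvgRW.treeTwoThree, 0, inferInstance,
      hG.isTree.connected, fun x => Set.toFinite _, AvgRW.simpleRW_isRandomWalk _ fun x =>
        two_pos.trans_le (hG.two_le_degree le_rfl (by norm_num) x),
      fun h => hadm h.1, fun h => hadm h.1⟩
  · exact hG.isTreeSecond.TOA hk (two_pos.trans_le hn) o
  · exact hG.TOA hk (two_pos.trans_le hn) o
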